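/- Let $\varphi\in L^1(\mathbb R)$ be a complex-valued function that is not zero almost everywhere. For $s\ge 0$ put $$p(s)=-\log\int_{|t|\ge s}|\varphi(t)|\,dt\in(-\infty,+\infty]$$ (with $p(s)=+\infty$ if the integral is $0$), and assume $\lim_{s\to\infty}p(s)/s=\infty$. For $\varepsilon>0$ let $$s_\varepsilon=\inf\{s>0:\ e^{-p(s)}\le\varepsilon\},\qquad \Phi^\varepsilon(z)=\int_{-s_\varepsilon}^{s_\varepsilon}e^{zt}\varphi(t)\,dt\quad(z\in\mathbb C).$$ Let $q>\tfrac12$ and $\beta>0$ be constants, and consider, for $R>0$, the equation $$\Big[(q+\tfrac12)\log R+\log(15e^3)\Big]\Big[\log\|\varphi\|_{L^1(\mathbb R)}+2e\,s_\varepsilon R\Big]=-\log(\varepsilon^\beta+\varepsilon).\qquad(*)$$ Then there is $\varepsilon_0>0$, depending only on $\varphi,q,\beta$, such that for every $0<\varepsilon<\varepsilon_0$ the equation $(*)$ has a solution $R>1$, and for every solution $R=R_\varepsilon>0$ of $(*)$ the set $$B=\{z\in\mathbb C:\ |\Phi^\varepsilon(z)|\le\varepsilon^\beta+\varepsilon,\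 |z|\le R_\varepsilon\}$$ has Lebesgue measure (area) $m(B)\le R_\varepsilon^{-q+\frac12}$. Moreover, $B$ is contained in the union of finitely many closed disks of positive radii (possibly no disks, if $B$ is empty) the sum of whose radii is at most $R_\varepsilon^{-q+\frac12}$. -/

import Mathlib

open MeasureTheory Filter Topology

noncomputable section

namespace SmallValued

/-- `p(s) = -log ∫_{|t| ≥ s} |φ(t)| dt`, as an extended real, so that `p(s) = +∞` exactly when
`φ` vanishes almost everywhere on `{|t| ≥ s}`. -/
def tailExponent (φ : ℝ → ℂ) (s : ℝ) : EReal :=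
  -ENNReal.log (∫⁻ t in {t : ℝ | s ≤ |t|}, ‖φ t‖ₑ)

/-- `s_ε = inf {s > 0 : e^{-p(s)} ≤ ε}`. -/
def truncationRadius (φ : ℝ → ℂ) (ε : ℝ) : ℝ :=
  sInf {s : ℝ | 0 < s ∧ EReal.exp (-tailExponent φ s) ≤ ENNReal.ofReal ε}

/-- `φ^ε(t) = φ(t)` for `|t| ≤ s_ε`, and `0` otherwise. -/
def truncation (φ : ℝ → ℂ) (ε : ℝ) : ℝ → ℂ :=
  {t : ℝ | |t| ≤ truncationRadius φ ε}.indicator φ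

/-- `Φ^ε(z) = ∫ e^{zt} φ^ε(t) dt`. -/
def truncatedLaplace (φ : ℝ → ℂ) (ε : ℝ) (z : ℂ) : ℂ :=
  ∫ t : ℝ, Complex.exp (z * (t : ℂ)) * truncation φ ε t

/-- The equation that determines `R = R_ε`. -/
def RadiusEquation (φ : ℝ → ℂ) (q β ε R : ℝ) : Prop :=
  ((q + 1 / 2) * Real.log R + Real.log (15 * Real.exp 3)) *
      (Real.log (∫ t : ℝ, ‖φ t‖) + 2 * Real.exp 1 * truncationRadius φ ε * R) =
    -Real.log (ε ^ β + ε)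

/-- `{z ∈ ℂ : |Φ^ε(z)| ≤ ε^β + ε, |z| ≤ R}`. -/
def smallValuedSet (φ : ℝ → ℂ) (β ε R : ℝ) : Set ℂ :=
  {z : ℂ | ‖truncatedLaplace φ ε z‖ ≤ ε ^ β + ε ∧ ‖z‖ ≤ R}

end SmallValued

end

/-! Cartan's estimate makes an entire function that is not small at one point large outside disks of
prescribed total radius `T`, with loss governed by `log M`, `M` its normalized maximum on a larger
disk (`exists_disks_exp_le_norm`). Zeros are counted by Jensen's argument and divided out;
Borel–Carathéodory bounds the zero-free part below, and Cartan's covering argument bounds the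
polynomial part. The centre `z₀` is a point of the imaginary axis where the full transform of `φ` is
nonzero. Such a point exists by Fourier injectivity, and truncation costs at most `ε` there, so
`|Φ^ε(z₀)|` stays above a fixed `κ`. With `T = R ^ (-q + 1/2)` the lower bound exceeds `ε ^ β + ε`
when `R` solves the equation and is large: moving the centre costs `O(s_ε log R)`, while the slack
in the constant 15 gains at least `s_ε R log 2` (`eventually_cartan_exponent_lt`). Since `s_ε =
o(log (1/ε))`, no solution lies in a fixed interval `[1/2, K]` for small `ε`; for `R < 1/2` the disk
`|z| ≤ R` itself suffices. -/

/-! ### Zeros and zero-free factors of entire functions. -/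

/-- Maximum principle for an entire function whose zeros `a k` have been replaced by the
denominators of the Blaschke factors of the disk of radius `ρ`. -/
theorem norm_mul_blaschke_le {n : ℕ} {a : Fin n → ℂ} {g : ℂ → ℂ} (hg : Differentiable ℂ g)
    {ρ M : ℝ} (hρ : 0 < ρ)
    (hM : ∀ z : ℂ, ‖z‖ ≤ ρ → ‖(∏ k, (z - a k)) * g z‖ ≤ M) {z : ℂ} (hz : ‖z‖ ≤ ρ) :
    ‖g z‖ * ∏ k, (‖(ρ : ℂ) ^ 2 - (starRingEnd ℂ) (a k) * z‖ / ρ) ≤ M := by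
  set F : ℂ → ℂ := fun z => g z * ∏ k, (((ρ : ℂ) ^ 2 - (starRingEnd ℂ) (a k) * z) / ρ) with hF
  have hFn : ∀ z, ‖F z‖ = ‖g z‖ * ∏ k, (‖(ρ : ℂ) ^ 2 - (starRingEnd ℂ) (a k) * z‖ / ρ) := by
    intro z
    simp only [hF, norm_mul, norm_prod, norm_div, Complex.norm_real, Real.norm_eq_abs,
      abs_of_pos hρ]
  have hFd : Differentiable ℂ F := by
    apply hg.mul
    fun_prop
  rw [← hFn]
  -- Blaschke factors have modulus 1 on `|w| = ρ`, so there `F` has the modulus of the original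
  -- function.
  refine Complex.norm_le_of_forall_mem_frontier_norm_le (U := Metric.ball (0 : ℂ) ρ)
    Metric.isBounded_ball hFd.diffContOnCl ?_ ?_
  · intro w hw
    rw [frontier_ball _ hρ.ne', mem_sphere_zero_iff_norm] at hw
    rw [hFn]
    refine le_trans (le_of_eq ?_) (hM w hw.le)
    rw [norm_mul, norm_prod, mul_comm]
    congr 1
    refine Finset.prod_congr rfl fun k _ => ?_
    have : (ρ : ℂ) ^ 2 - (starRingEnd ℂ) (a k) * w = w * (starRingEnd ℂ) (w - a k) := by
      have : w * (starRingEnd ℂ) w = (ρ : ℂ) ^ 2 := by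
        rw [Complex.mul_conj, Complex.normSq_eq_norm_sq, hw]; push_cast; rfl
      rw [map_sub, mul_sub, this]; ring
    rw [this, norm_mul, hw, RCLike.norm_conj]
    field_simp
  · rw [closure_ball _ hρ.ne']
    simpa using hz

/-- Counting zeros: an entire function of norm `1` at the origin which is at most `M` on the disk of
radius `e r` has at most `log M` zeros in the disk of radius `r`. -/
theorem exp_card_zeros_le {n : ℕ} {a : Fin n → ℂ} {g : ℂ → ℂ} (hg : Differentiable ℂ g)
    {r M : ℝ} (hr : 0 < r) (ha : ∀ k, ‖a k‖ ≤ r)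
    (h0 : ‖(∏ k, (0 - a k)) * g 0‖ = 1)
    (hM : ∀ z : ℂ, ‖z‖ ≤ Real.exp 1 * r → ‖(∏ k, (z - a k)) * g z‖ ≤ M) :
    Real.exp n ≤ M := by
  have hρ : 0 < Real.exp 1 * r := by positivity
  have h := norm_mul_blaschke_le hg hρ hM (z := 0) (by simpa using hρ.le)
  have e1 : ∀ k, ‖((Real.exp 1 * r : ℝ) : ℂ) ^ 2 - (starRingEnd ℂ) (a k) * 0‖ / (Real.exp 1 * r)
      = Real.exp 1 * r := by
    intro k
    rw [mul_zero, sub_zero, norm_pow, Complex.norm_real, Real.norm_eq_abs, abs_of_pos hρ]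
    field_simp
  simp only [e1, Finset.prod_const, Finset.card_univ, Fintype.card_fin] at h
  -- At the origin each denominator contributes `e r`, while `|a k| ≤ r`: every zero gains a factor
  -- `e`.
  have h1 : 1 ≤ ‖g 0‖ * r ^ n := by
    rw [← h0, norm_mul, norm_prod, mul_comm]
    gcongr
    calc ∏ k, ‖0 - a k‖ ≤ ∏ _k : Fin n, r :=
          Finset.prod_le_prod (fun _ _ => norm_nonneg _) (fun k _ => by simpa using ha k)
      _ = r ^ n := by simp
  calc Real.exp n = Real.exp 1 ^ n := by rw [← Real.exp_nat_mul, mul_one]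
    _ ≤ Real.exp 1 ^ n * (‖g 0‖ * r ^ n) := le_mul_of_one_le_right (by positivity) h1
    _ = ‖g 0‖ * (Real.exp 1 * r) ^ n := by rw [mul_pow]; ring
    _ ≤ M := h

/-- The zeros of an entire function in a disk can be divided out. -/
theorem exists_eq_prod_mul_ne_zero {f : ℂ → ℂ} (hf : Differentiable ℂ f) (h0 : ‖f 0‖ = 1)
    {r M : ℝ} (hr : 0 < r) (hM : ∀ z : ℂ, ‖z‖ ≤ Real.exp 1 * r → ‖f z‖ ≤ M) :
    ∃ (n : ℕ) (a : Fin n → ℂ) (g : ℂ → ℂ), Differentiable ℂ g ∧ (∀ k, ‖a k‖ < r) ∧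
      (∀ z, f z = (∏ k, (z - a k)) * g z) ∧ (∀ z, ‖z‖ < r → g z ≠ 0) ∧ Real.exp n ≤ M := by
  classical
  let P : ℕ → Prop := fun n => ∃ (a : Fin n → ℂ) (g : ℂ → ℂ), Differentiable ℂ g ∧
    (∀ k, ‖a k‖ < r) ∧ ∀ z, f z = (∏ k, (z - a k)) * g z
  have hexp : ∀ n, P n → Real.exp n ≤ M := by
    rintro n ⟨a, g, hg, ha, hfg⟩
    exact exp_card_zeros_le hg hr (fun k => (ha k).le) (by rw [← hfg, h0])
      (fun z hz => by rw [← hfg]; exact hM z hz)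
  have hP0 : P 0 := ⟨Fin.elim0, f, hf, fun k => k.elim0, by simp⟩
  have hbd : ∀ n, P n → n ≤ ⌈M⌉₊ := by
    intro n hn
    have := hexp n hn
    have h2 := Real.add_one_le_exp (n : ℝ)
    exact_mod_cast (by linarith : (n : ℝ) ≤ M).trans (Nat.le_ceil M)
  -- Take the largest number of zeros that can be divided out; a further zero of `g` would allow one
  -- more division, by `dslope`.
  set N := Nat.findGreatest P ⌈M⌉₊ with hN
  have hPN : P N := Nat.findGreatest_spec (Nat.zero_le _) hP0
  obtain ⟨a, g, hg, ha, hfg⟩ := id hPN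
  refine ⟨N, a, g, hg, ha, hfg, fun z hz hgz => ?_, hexp N hPN⟩
  have hP1 : P (N + 1) := by
    refine ⟨Fin.cons z a, dslope g z, ?_, ?_, ?_⟩
    · have := (Complex.differentiableOn_dslope (c := z) (s := Set.univ) Filter.univ_mem).2
        hg.differentiableOn
      exact differentiableOn_univ.1 this
    · intro k
      refine Fin.cases ?_ (fun k => ?_) k
      · simpa using hz
      · simpa using ha k
    · intro w
      rw [Fin.prod_univ_succ]
      simp only [Fin.cons_zero, Fin.cons_succ]
      have := sub_smul_dslope g z w
      rw [hgz, sub_zero, smul_eq_mul] at this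
      rw [hfg w, ← this]; ring
  have := Nat.le_findGreatest (hbd _ hP1) hP1
  omega

/-- A nonvanishing holomorphic function bounded by `M` on a disk and of norm at least `1` at the
center is at least `M⁻²` on the concentric disk of half the radius. -/
theorem neg_two_mul_log_le_log_norm {ψ : ℂ → ℂ} (hψ : Differentiable ℂ ψ) {r M : ℝ} (hr : 0 < r)
    (hM1 : 1 < M) (hne : ∀ z, ‖z‖ < r → ψ z ≠ 0) (hM : ∀ z, ‖z‖ < r → ‖ψ z‖ ≤ M)
    (h0 : 1 ≤ ‖ψ 0‖) {z : ℂ} (hz : ‖z‖ ≤ r / 2) : -(2 * Real.log M) ≤ Real.log ‖ψ z‖ := by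
  have hlogM := Real.log_pos hM1
  have hzr : ‖z‖ < r := by linarith
  have hharm : InnerProductSpace.HarmonicOnNhd (fun z => Real.log ‖ψ z‖) (Metric.ball 0 r) :=
    fun z hz => (hψ.analyticAt z).harmonicAt_log_norm (hne z (by simpa using hz))
  -- `F` is a branch of `log ψ` up to an imaginary constant. Since `log |ψ 0| ≥ 0`, the real part of
  -- `F - F 0` is still at most `log M`.
  obtain ⟨F, hFa, hF⟩ := InnerProductSpace.HarmonicOnNhd.exists_analyticOnNhd_ball_re_eq hharm
  have hFre : ∀ w, ‖w‖ < r → (F w).re = Real.log ‖ψ w‖ := fun w hw =>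
    hF (by simpa using hw)
  have hl0 : 0 ≤ Real.log ‖ψ 0‖ := Real.log_nonneg h0
  have hBC := Complex.borelCaratheodory_zero (f := fun w => F w - F 0) (M := Real.log M) (R := r)
    hlogM ((hFa.differentiableOn).sub_const _) (fun w hw => by
      have hw' : ‖w‖ < r := by simpa using hw
      show (F w - F 0).re ≤ Real.log M
      rw [Complex.sub_re, hFre w hw', hFre 0 (by simpa using hr)]
      have := Real.log_le_log (norm_pos_iff.2 (hne w hw')) (hM w hw')
      linarith) hr (z := z) (by simpa using hzr) (by simp)
  have h2 : 2 * Real.log M * ‖z‖ / (r - ‖z‖) ≤ 2 * Real.log M := by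
    rw [div_le_iff₀ (by linarith)]
    have : ‖z‖ ≤ r - ‖z‖ := by linarith
    gcongr
  have h3 := (abs_le.1 ((Complex.abs_re_le_norm (F z - F 0)).trans (hBC.trans h2))).1
  rw [Complex.sub_re, hFre z hzr, hFre 0 (by simpa using hr)] at h3
  linarith

/-! ### Cartan's estimate. -/

/-- Cartan's covering argument. -/
theorem exists_disks_card_lt {ι : Type*} (a : ι → ℂ) {δ : ℝ} (hδ : 0 ≤ δ) (S : Finset ι) :
    ∃ (N : ℕ) (c : Fin N → ℂ) (m : Fin N → ℕ), (∀ i, 0 < m i) ∧ ∑ i, m i ≤ S.card ∧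
      ∀ z, (∀ i, 2 * (m i * δ) < dist z (c i)) →
        ∀ j : ℕ, 0 < j → (S.filter fun k => dist z (a k) ≤ j * δ).card < j := by
  classical
  induction S using Finset.strongInduction with
  | H S ih =>
    let P : ℕ → Prop := fun j =>
      0 < j ∧ ∃ z, j ≤ (S.filter fun k => dist z (a k) ≤ j * δ).card
    have hPle : ∀ j, P j → j ≤ S.card := fun j ⟨_, z, hz⟩ =>
      hz.trans (Finset.card_filter_le _ _)
    by_cases hP : ∃ j, P j
    · obtain ⟨j₀, hj₀⟩ := hP
      -- Greedy choice: the largest `j` for which some disk of radius `j δ` holds at least `j`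
      -- points. Those points are removed and the disk is doubled.
      set j := Nat.findGreatest P S.card with hj
      obtain ⟨hjpos, z₀, hz₀⟩ : P j := Nat.findGreatest_spec (hPle _ hj₀) hj₀
      have hmax : ∀ i, P i → i ≤ j := fun i hi => Nat.le_findGreatest (hPle i hi) hi
      set T := S.filter fun k => dist z₀ (a k) ≤ j * δ with hT
      have hTS : T ⊆ S := Finset.filter_subset _ _
      have hTne : T.Nonempty := Finset.card_pos.1 (hjpos.trans_le hz₀)
      obtain ⟨N, c, m, hm, hsum, hcov⟩ := ih (S \ T) (Finset.sdiff_ssubset hTS hTne)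
      refine ⟨N + 1, Fin.cons z₀ c, Fin.cons j m, ?_, ?_, ?_⟩
      · intro i
        refine Fin.cases ?_ (fun i => ?_) i
        · simpa using hjpos
        · simpa using hm i
      · rw [Fin.sum_univ_succ]
        simp only [Fin.cons_zero, Fin.cons_succ]
        rw [Finset.card_sdiff_of_subset hTS] at hsum
        have := Finset.card_le_card hTS
        omega
      · intro z hz i hi
        by_contra hcon
        push Not at hcon
        have hij : i ≤ j := hmax i ⟨hi, z, hcon⟩
        have hz0 := hz 0
        simp only [Fin.cons_zero] at hz0
        have hlt := hcov z (fun i => by simpa using hz i.succ) i hi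
        -- As `i ≤ j` and `z` is farther than `2 j δ` from `z₀`, the disk of radius `i δ` about `z`
        -- misses every removed point.
        have hsub : (S.filter fun k => dist z (a k) ≤ i * δ) ⊆
            ((S \ T).filter fun k => dist z (a k) ≤ i * δ) := by
          intro k hk
          rw [Finset.mem_filter] at hk
          rw [Finset.mem_filter, Finset.mem_sdiff]
          refine ⟨⟨hk.1, fun hkT => ?_⟩, hk.2⟩
          have h1 := (Finset.mem_filter.1 hkT).2
          have h2 : (i : ℝ) * δ ≤ j * δ := by gcongr
          have h3 := dist_triangle_right z z₀ (a k)
          linarith [hk.2]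
        have := Finset.card_le_card hsub
        omega
    · refine ⟨0, Fin.elim0, Fin.elim0, fun i => i.elim0, by simp, fun z _ j hj => ?_⟩
      by_contra hcon
      exact hP ⟨j, hj, z, not_lt.1 hcon⟩

/-- In increasing order, the `j`-th of the `d k` exceeds `j δ`. The induction removes an element
exceeding `S.card * δ`. -/
theorem factorial_mul_pow_le_prod {ι : Type*} {d : ι → ℝ} {δ : ℝ} (hδ : 0 ≤ δ) (S : Finset ι)
    (h : ∀ j : ℕ, 0 < j → (S.filter fun k => d k ≤ j * δ).card < j) :
    (S.card.factorial : ℝ) * δ ^ S.card ≤ ∏ k ∈ S, d k := by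
  classical
  induction S using Finset.strongInduction with
  | H S ih =>
    rcases S.eq_empty_or_nonempty with rfl | hS
    · simp
    · have hlt := h S.card hS.card_pos
      obtain ⟨k, hkS, hk⟩ : ∃ k ∈ S, S.card * δ < d k := by
        by_contra! hcon
        rw [Finset.filter_true_of_mem hcon] at hlt
        exact lt_irrefl _ hlt
      have ih' := ih (S.erase k) (Finset.erase_ssubset hkS) fun j hj =>
        (Finset.card_le_card (Finset.filter_subset_filter _ (Finset.erase_subset _ _))).trans_lt
          (h j hj)
      rw [← Finset.mul_prod_erase S d hkS]
      have hc : S.card = (S.erase k).card + 1 := (Finset.card_erase_add_one hkS).symm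
      have : (S.card.factorial : ℝ) * δ ^ S.card =
          (S.card * δ) * (((S.erase k).card.factorial : ℝ) * δ ^ (S.erase k).card) := by
        rw [hc, Nat.factorial_succ, pow_succ]; push_cast; ring
      rw [this]
      have h0 : 0 ≤ (S.card : ℝ) * δ := by positivity
      exact mul_le_mul hk.le ih' (by positivity) (h0.trans hk.le)

/-- **Cartan's estimate**: lower bound for an entire function outside small disks. -/
theorem exists_disks_exp_le_norm {f : ℂ → ℂ} (hf : Differentiable ℂ f) (h0 : ‖f 0‖ = 1)
    {R M T : ℝ} (hR : 0 < R) (hM1 : 1 < M) (hT : 0 < T) (hTR : T ≤ 6 * Real.exp 1 * R)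
    (hM : ∀ z : ℂ, ‖z‖ ≤ 2 * Real.exp 1 * R → ‖f z‖ ≤ M) :
    ∃ (N : ℕ) (c : Fin N → ℂ) (r : Fin N → ℝ), (∀ i, 0 < r i) ∧ ∑ i, r i ≤ T ∧
      ∀ z : ℂ, ‖z‖ ≤ R → (∀ i, z ∉ Metric.closedBall (c i) (r i)) →
        Real.exp (-((2 + Real.log (6 * Real.exp 1 * R / T)) * Real.log M)) ≤ ‖f z‖ := by
  have hlogM := Real.log_pos hM1
  have h2R : 0 < 2 * R := by positivity
  obtain ⟨n, a, g, hg, ha, hfg, hgne, hn⟩ := exists_eq_prod_mul_ne_zero hf h0 h2R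
    (fun z hz => hM z (by linarith))
  -- Quotient of `f` by its Blaschke product on the disk of radius `2R`: zero-free there, still
  -- bounded by `M`, and at least 1 in modulus at 0.
  set ψ : ℂ → ℂ := fun z =>
    g z * ∏ k, ((((2 * R : ℝ) : ℂ) ^ 2 - (starRingEnd ℂ) (a k) * z) / ((2 * R : ℝ) : ℂ)) with hψ
  have hψn : ∀ z, ‖ψ z‖ =
      ‖g z‖ * ∏ k, (‖((2 * R : ℝ) : ℂ) ^ 2 - (starRingEnd ℂ) (a k) * z‖ / (2 * R)) := by
    intro z
    simp only [hψ, norm_mul, norm_prod, norm_div, Complex.norm_real, Real.norm_eq_abs,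
      Nat.abs_ofNat, abs_of_pos hR]
  have hψd : Differentiable ℂ ψ := by
    apply hg.mul
    fun_prop
  have hψne : ∀ z, ‖z‖ < 2 * R → ψ z ≠ 0 := by
    intro z hz
    refine mul_ne_zero (hgne z hz) (Finset.prod_ne_zero_iff.2 fun k _ => ?_)
    refine div_ne_zero (fun h => ?_) (by exact_mod_cast h2R.ne')
    have h1 : ‖((2 * R : ℝ) : ℂ) ^ 2‖ = ‖(starRingEnd ℂ) (a k) * z‖ := by
      rw [sub_eq_zero.1 h]
    rw [norm_pow, Complex.norm_real, Real.norm_eq_abs, abs_of_pos h2R, norm_mul,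
      RCLike.norm_conj] at h1
    have h2 := ha k
    nlinarith [norm_nonneg (a k), norm_nonneg z]
  have he1 : 1 ≤ Real.exp 1 := Real.one_le_exp zero_le_one
  have hψM : ∀ z, ‖z‖ < 2 * R → ‖ψ z‖ ≤ M := by
    intro z hz
    rw [hψn]
    refine norm_mul_blaschke_le hg h2R (fun w hw => ?_) hz.le
    rw [← hfg]
    exact hM w (by nlinarith)
  have hψ0 : 1 ≤ ‖ψ 0‖ := by
    rw [hψn, ← h0, hfg, norm_mul, norm_prod, mul_comm]
    gcongr with k
    rw [mul_zero, sub_zero, norm_pow, Complex.norm_real, Real.norm_eq_abs, abs_of_pos h2R, zero_sub,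
      norm_neg]
    have := (ha k).le
    field_simp
    exact this
  -- The radii are `2 m_i δ` with `∑ m_i ≤ n`, so they add up to at most `T`. For `n = 0` this is `δ
  -- = 0` and there are no disks.
  set δ : ℝ := T / (2 * n) with hδ
  have hδ0 : 0 ≤ δ := by positivity
  obtain ⟨N, c, m, hm, hsum, hcov⟩ := exists_disks_card_lt a hδ0 Finset.univ
  rw [Finset.card_univ, Fintype.card_fin] at hsum
  refine ⟨N, c, fun i => 2 * (m i * δ), fun i => ?_, ?_, fun z hz hzc => ?_⟩
  · have hn0 : 0 < n := (hm i).trans_le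
      ((Finset.single_le_sum (f := m) (fun _ _ => Nat.zero_le _) (Finset.mem_univ i)).trans hsum)
    have := hm i
    positivity
  · rw [← Finset.mul_sum, ← Finset.sum_mul]
    have h1 : (∑ i, (m i : ℝ)) ≤ n := by exact_mod_cast hsum
    calc 2 * ((∑ i, (m i : ℝ)) * δ) ≤ 2 * (n * δ) := by gcongr
      _ ≤ T := by
        rcases Nat.eq_zero_or_pos n with h | h
        · simp [h, hT.le]
        · rw [hδ]; field_simp; exact le_refl _
  · have hprod := factorial_mul_pow_le_prod (d := fun k => dist z (a k)) hδ0 Finset.univ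
      (hcov z fun i => by simpa using hzc i)
    rw [Finset.card_univ, Fintype.card_fin] at hprod
    have hTn : T ^ n ≤ n.factorial * δ ^ n * (2 * Real.exp 1) ^ n := by
      have e1 : T ^ n = (n : ℝ) ^ n * (2 * δ) ^ n := by
        rcases Nat.eq_zero_or_pos n with h | h
        · simp [h]
        · rw [← mul_pow, hδ]; congr 1; field_simp
      have e2 : (n : ℝ) ^ n ≤ n.factorial * Real.exp 1 ^ n := by
        have := Real.pow_div_factorial_le_exp (n : ℝ) (Nat.cast_nonneg n) n
        rw [div_le_iff₀ (by positivity)] at this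
        rw [← Real.exp_nat_mul, mul_one]
        linarith
      rw [e1]
      calc (n : ℝ) ^ n * (2 * δ) ^ n ≤ n.factorial * Real.exp 1 ^ n * (2 * δ) ^ n := by gcongr
        _ = _ := by rw [mul_pow, mul_pow]; ring
    -- For `|z| ≤ R` each factor is at most `(4R² + 2R·R) / (2R) = 3R`; with the `2e` above this
    -- yields the constant `6e`.
    have hψz : ‖ψ z‖ ≤ ‖g z‖ * (3 * R) ^ n := by
      rw [hψn]
      gcongr
      calc _ ≤ ∏ _k : Fin n, (3 * R) := by
            refine Finset.prod_le_prod (fun _ _ => by positivity) fun k _ => ?_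
            rw [div_le_iff₀ h2R]
            refine (norm_sub_le _ _).trans ?_
            rw [norm_pow, Complex.norm_real, Real.norm_eq_abs, abs_of_pos h2R, norm_mul,
              RCLike.norm_conj]
            have := ha k
            nlinarith [norm_nonneg (a k), norm_nonneg z]
        _ = _ := by simp
    have hlow := neg_two_mul_log_le_log_norm hψd h2R hM1 hψne hψM hψ0 (z := z) (by linarith)
    rw [Real.le_log_iff_exp_le (norm_pos_iff.2 (hψne z (by linarith)))] at hlow
    set Q := 6 * Real.exp 1 * R / T with hQ
    -- `log Q ≥ 0` is what permits replacing `n` by its upper bound `log M`.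
    have hQ1 : 1 ≤ Q := (one_le_div hT).2 hTR
    have hnlog : (n : ℝ) ≤ Real.log M := (Real.le_log_iff_exp_le (by linarith)).2 hn
    have hQn : Real.exp (-(Real.log Q * Real.log M)) ≤ (T / (6 * Real.exp 1 * R)) ^ n := by
      have : T / (6 * Real.exp 1 * R) = Real.exp (-Real.log Q) := by
        rw [Real.exp_neg, Real.exp_log (by linarith), hQ, inv_div]
      rw [this, ← Real.exp_nat_mul, Real.exp_le_exp]
      have := Real.log_nonneg hQ1
      nlinarith
    have hd : ∏ k, ‖z - a k‖ = ∏ k, dist z (a k) := by simp [dist_eq_norm]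
    calc Real.exp (-((2 + Real.log Q) * Real.log M))
        = Real.exp (-(Real.log Q * Real.log M)) * Real.exp (-(2 * Real.log M)) := by
          rw [← Real.exp_add]; ring_nf
      _ ≤ (T / (6 * Real.exp 1 * R)) ^ n * (‖g z‖ * (3 * R) ^ n) := by
          gcongr
          exact hlow.trans hψz
      _ = T ^ n / (2 * Real.exp 1) ^ n * ‖g z‖ := by
          have : (6 * Real.exp 1 * R) = (2 * Real.exp 1) * (3 * R) := by ring
          rw [this, div_pow, mul_pow (2 * Real.exp 1)]
          field_simp
      _ ≤ (n.factorial * δ ^ n) * ‖g z‖ := by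
          gcongr
          rw [div_le_iff₀ (by positivity)]
          exact hTn
      _ ≤ (∏ k, dist z (a k)) * ‖g z‖ := by gcongr
      _ = ‖f z‖ := by rw [hfg, norm_mul, norm_prod, hd]

/-! ### Laplace and Fourier integrals. -/

theorem differentiable_integral_cexp_mul {ψ : ℝ → ℂ} (hψ : Integrable ψ) {s : ℝ}
    (hs : ∀ t, s < |t| → ψ t = 0) :
    Differentiable ℂ fun z : ℂ => ∫ t : ℝ, Complex.exp (z * (t : ℂ)) * ψ t := by
  have hexp : ∀ (z : ℂ) (t : ℝ), ‖Complex.exp (z * t)‖ ≤ Real.exp (‖z‖ * |t|) := fun z t => by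
    refine (Complex.norm_exp_le_exp_norm _).trans (le_of_eq ?_)
    rw [norm_mul, Complex.norm_real, Real.norm_eq_abs]
  have hmeas : ∀ z : ℂ, AEStronglyMeasurable (fun t : ℝ => Complex.exp (z * (t : ℂ)) * ψ t) :=
    fun z => (Continuous.aestronglyMeasurable (by fun_prop)).mul hψ.aestronglyMeasurable
  intro z₀
  refine (hasDerivAt_integral_of_dominated_loc_of_deriv_le (𝕜 := ℂ)
    (F := fun z t => Complex.exp (z * (t : ℂ)) * ψ t)
    (F' := fun z t => Complex.exp (z * (t : ℂ)) * t * ψ t)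
    (bound := fun t => Real.exp ((‖z₀‖ + 1) * |s|) * |s| * ‖ψ t‖)
    (Metric.ball_mem_nhds z₀ one_pos) (Eventually.of_forall hmeas) ?_ ?_ ?_ ?_ ?_).2.differentiableAt
  · refine (hψ.norm.const_mul (Real.exp (‖z₀‖ * |s|))).mono' (hmeas z₀)
      (Eventually.of_forall fun t => ?_)
    rcases lt_or_ge s |t| with h | h
    · simp [hs t h]
    · rw [norm_mul]
      gcongr
      refine (hexp _ _).trans (Real.exp_le_exp.2 ?_)
      have := h.trans (le_abs_self s)
      gcongr
  · exact (Continuous.aestronglyMeasurable (by fun_prop)).mul hψ.aestronglyMeasurable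
  · refine Eventually.of_forall fun t z hz => ?_
    rcases lt_or_ge s |t| with h | h
    · simp [hs t h]
    · have h' := h.trans (le_abs_self s)
      have hz' : ‖z‖ ≤ ‖z₀‖ + 1 := by
        have h1 := norm_le_norm_add_norm_sub' z z₀
        have h2 : ‖z - z₀‖ < 1 := by simpa [dist_eq_norm] using hz
        linarith
      rw [norm_mul, norm_mul, Complex.norm_real, Real.norm_eq_abs]
      gcongr
      refine (hexp _ _).trans (Real.exp_le_exp.2 ?_)
      gcongr
  · exact hψ.norm.const_mul _
  · refine Eventually.of_forall fun t z _ => ?_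
    have : HasDerivAt (fun z : ℂ => Complex.exp (z * (t : ℂ))) (Complex.exp (z * t) * (1 * t)) z :=
      ((hasDerivAt_id z).mul_const (t : ℂ)).cexp
    simpa using this.mul_const (ψ t)

theorem norm_integral_cexp_mul_le {ψ : ℝ → ℂ} (hψ : Integrable ψ) {s : ℝ}
    (hs : ∀ t, s < |t| → ψ t = 0) (z : ℂ) :
    ‖∫ t : ℝ, Complex.exp (z * (t : ℂ)) * ψ t‖ ≤ (∫ t, ‖ψ t‖) * Real.exp (s * ‖z‖) := by
  rw [← integral_mul_const]
  refine norm_integral_le_of_norm_le (hψ.norm.mul_const _) (Eventually.of_forall fun t => ?_)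
  rcases lt_or_ge s |t| with h | h
  · simp [hs t h]
  · rw [norm_mul, mul_comm]
    gcongr
    refine (Complex.norm_exp_le_exp_norm _).trans (Real.exp_le_exp.2 ?_)
    rw [norm_mul, Complex.norm_real, Real.norm_eq_abs, mul_comm]
    gcongr

/-- Injectivity of the Fourier transform on `L¹(ℝ)`. -/
theorem exists_integral_cexp_mul_ne_zero {φ : ℝ → ℂ} (hφ : Integrable φ) (hφ0 : ¬ φ =ᵐ[volume] 0) :
    ∃ y : ℝ, ∫ t : ℝ, Complex.exp ((y * Complex.I : ℂ) * (t : ℂ)) * φ t ≠ 0 := by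
  by_contra! hcon
  have hF : ∀ w, FourierTransform.fourier φ w = 0 := by
    intro w
    rw [Real.fourier_real_eq_integral_exp_smul, ← hcon (-2 * Real.pi * w)]
    refine integral_congr_ae (Eventually.of_forall fun t => ?_)
    simp only [smul_eq_mul]
    congr 2
    push_cast
    ring
  apply hφ0
  refine ae_eq_zero_of_integral_contDiff_smul_eq_zero hφ.locallyIntegrable fun g hg hgc => ?_
  have hg₁ : HasCompactSupport (Complex.ofRealCLM ∘ g) := hgc.comp_left rfl
  have hg₂ : ContDiff ℝ ((⊤ : ℕ∞) : WithTop ℕ∞) (Complex.ofRealCLM ∘ g) := by fun_prop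
  -- Write the test function as the Fourier transform of a Schwartz function `K` and move the
  -- transform onto `φ`, where it vanishes.
  let G : SchwartzMap ℝ ℂ := hg₁.toSchwartzMap hg₂
  let K : SchwartzMap ℝ ℂ := FourierTransformInv.fourierInv G
  have hK : FourierTransform.fourier (K : ℝ → ℂ) = G := by
    rw [← SchwartzMap.fourier_coe, FourierTransform.fourier_fourierInv_eq]
  have h := VectorFourier.integral_fourierIntegral_smul_eq_flip (L := innerₗ ℝ)
      (μ := volume) (ν := volume) (f := φ) (g := (K : ℝ → ℂ))
      Real.continuous_fourierChar continuous_inner hφ K.integrable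
  have e1 : ∀ w, VectorFourier.fourierIntegral Real.fourierChar volume (innerₗ ℝ) φ w = 0 :=
    fun w => hF w
  have e2 : VectorFourier.fourierIntegral Real.fourierChar volume (innerₗ ℝ).flip (K : ℝ → ℂ)
      = G := by
    rw [flip_innerₗ]; exact hK
  rw [e2] at h
  simp only [e1, zero_smul, integral_zero] at h
  rw [h]
  refine integral_congr_ae (Eventually.of_forall fun t => ?_)
  simp only [smul_eq_mul, Complex.real_smul]
  rw [mul_comm]
  rfl

/-! ### Truncation radius and truncated transform. -/

namespace SmallValued

theorem exp_neg_tailExponent (φ : ℝ → ℂ) (s : ℝ) :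
    EReal.exp (-tailExponent φ s) = ∫⁻ t in {t : ℝ | s ≤ |t|}, ‖φ t‖ₑ := by
  rw [tailExponent, neg_neg, ENNReal.exp_log]

theorem measurableSet_le_abs (s : ℝ) : MeasurableSet {t : ℝ | s ≤ |t|} :=
  measurableSet_le measurable_const continuous_abs.measurable

theorem tail_antitone (φ : ℝ → ℂ) : Antitone fun s : ℝ => ∫⁻ t in {t : ℝ | s ≤ |t|}, ‖φ t‖ₑ :=
  fun _ _ h => lintegral_mono_set fun _ ht => le_trans h ht

theorem mem_truncationSet {φ : ℝ → ℂ} {ε s : ℝ} :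
    s ∈ {s : ℝ | 0 < s ∧ EReal.exp (-tailExponent φ s) ≤ ENNReal.ofReal ε} ↔
      0 < s ∧ ∫⁻ t in {t : ℝ | s ≤ |t|}, ‖φ t‖ₑ ≤ ENNReal.ofReal ε := by
  rw [Set.mem_ofPred_eq, exp_neg_tailExponent]

theorem truncationSet_bddBelow (φ : ℝ → ℂ) (ε : ℝ) :
    BddBelow {s : ℝ | 0 < s ∧ EReal.exp (-tailExponent φ s) ≤ ENNReal.ofReal ε} :=
  ⟨0, fun _ hs => hs.1.le⟩

theorem truncationRadius_nonneg (φ : ℝ → ℂ) (ε : ℝ) : 0 ≤ truncationRadius φ ε :=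
  Real.sInf_nonneg fun _ hs => hs.1.le

theorem exists_forall_tail_le {φ : ℝ → ℂ}
    (hp : Tendsto (fun s : ℝ => tailExponent φ s / (s : EReal)) atTop (𝓝 ⊤)) (N : ℝ) :
    ∃ s₁ : ℝ, 0 < s₁ ∧ ∀ s, s₁ ≤ s →
      ∫⁻ t in {t : ℝ | s ≤ |t|}, ‖φ t‖ₑ ≤ ENNReal.ofReal (Real.exp (-(N * s))) := by
  have h1 : ∀ᶠ s : ℝ in atTop, (N : EReal) < tailExponent φ s / (s : EReal) :=
    hp.eventually (lt_mem_nhds (EReal.coe_lt_top N))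
  obtain ⟨s₁, hs₁⟩ := eventually_atTop.1 h1
  refine ⟨max s₁ 1, by positivity, fun s hs => ?_⟩
  have hs0 : 0 < s := lt_of_lt_of_le (by positivity) hs
  have h2 := (hs₁ s ((le_max_left _ _).trans hs)).le
  rw [EReal.le_div_iff_mul_le (by exact_mod_cast hs0) (EReal.coe_ne_top s)] at h2
  rw [← exp_neg_tailExponent, ← EReal.exp_coe, EReal.exp_le_exp_iff, EReal.coe_neg,
    EReal.neg_le_neg_iff, EReal.coe_mul]
  exact h2

theorem truncationSet_nonempty {φ : ℝ → ℂ}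
    (hp : Tendsto (fun s : ℝ => tailExponent φ s / (s : EReal)) atTop (𝓝 ⊤)) {ε : ℝ} (hε : 0 < ε) :
    {s : ℝ | 0 < s ∧ EReal.exp (-tailExponent φ s) ≤ ENNReal.ofReal ε}.Nonempty := by
  obtain ⟨s₁, hs₁, h⟩ := exists_forall_tail_le hp 1
  refine ⟨max s₁ (-Real.log ε), mem_truncationSet.2 ⟨by positivity, (h _ (le_max_left _ _)).trans ?_⟩⟩
  refine ENNReal.ofReal_le_ofReal ?_
  rw [← Real.le_log_iff_exp_le hε]
  linarith [le_max_right s₁ (-Real.log ε)]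

/-- At `s = max s₁ (log (1/ε) / N)` the tail is at most `e^{-N s} ≤ ε`. As `N` is arbitrary, `s_ε =
o(log (1/ε))`. -/
theorem exists_truncationRadius_le {φ : ℝ → ℂ}
    (hp : Tendsto (fun s : ℝ => tailExponent φ s / (s : EReal)) atTop (𝓝 ⊤)) {N : ℝ} (hN : 0 < N) :
    ∃ s₁ : ℝ, 0 < s₁ ∧ ∀ ε, 0 < ε → truncationRadius φ ε ≤ max s₁ (-Real.log ε / N) := by
  obtain ⟨s₁, hs₁, h⟩ := exists_forall_tail_le hp N
  refine ⟨s₁, hs₁, fun ε hε => csInf_le (truncationSet_bddBelow φ ε)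
    (mem_truncationSet.2 ⟨by positivity, (h _ (le_max_left _ _)).trans ?_⟩)⟩
  refine ENNReal.ofReal_le_ofReal ?_
  rw [← Real.le_log_iff_exp_le hε]
  have := (div_le_iff₀ hN).1 (le_max_right s₁ (-Real.log ε / N))
  linarith

theorem iUnion_le_abs (s : ℝ) :
    ⋃ n : ℕ, {t : ℝ | s + 1 / ((n : ℝ) + 1) ≤ |t|} = {t : ℝ | s < |t|} := by
  ext t
  simp only [Set.mem_iUnion, Set.mem_ofPred_eq]
  constructor
  · rintro ⟨n, hn⟩
    have : (0 : ℝ) < 1 / ((n : ℝ) + 1) := by positivity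
    linarith
  · intro h
    obtain ⟨n, hn⟩ := exists_nat_one_div_lt (sub_pos.2 h)
    exact ⟨n, by linarith⟩

/-- Continuity from below along the tails starting at `s + 1/(n+1)`. It serves at `s = s_ε`, and at
`s = 0` with `C = 0`. -/
theorem setLIntegral_lt_abs_le (φ : ℝ → ℂ) (s : ℝ) {C : ENNReal}
    (h : ∀ s', s < s' → ∫⁻ t in {t : ℝ | s' ≤ |t|}, ‖φ t‖ₑ ≤ C) :
    ∫⁻ t in {t : ℝ | s < |t|}, ‖φ t‖ₑ ≤ C := by
  have hmono : Monotone fun n : ℕ => {t : ℝ | s + 1 / ((n : ℝ) + 1) ≤ |t|} := by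
    intro m n hmn t ht
    simp only [Set.mem_ofPred_eq] at ht ⊢
    refine le_trans ?_ ht
    have : (m : ℝ) ≤ n := by exact_mod_cast hmn
    gcongr
  have hm : MeasurableSet {t : ℝ | s < |t|} :=
    measurableSet_lt measurable_const continuous_abs.measurable
  rw [← withDensity_apply _ hm, ← iUnion_le_abs, hmono.measure_iUnion]
  refine iSup_le fun n => ?_
  rw [withDensity_apply _ (measurableSet_le_abs _)]
  exact h _ (lt_add_of_pos_right _ (by positivity))

theorem setLIntegral_truncationRadius_lt_abs_le {φ : ℝ → ℂ}
    (hp : Tendsto (fun s : ℝ => tailExponent φ s / (s : EReal)) atTop (𝓝 ⊤)) {ε : ℝ} (hε : 0 < ε) :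
    ∫⁻ t in {t : ℝ | truncationRadius φ ε < |t|}, ‖φ t‖ₑ ≤ ENNReal.ofReal ε := by
  refine setLIntegral_lt_abs_le φ _ fun s hs => ?_
  obtain ⟨s', hs', hlt⟩ := exists_lt_of_csInf_lt (truncationSet_nonempty hp hε) hs
  exact (tail_antitone φ hlt.le).trans (mem_truncationSet.1 hs').2

/-- Some tail has positive mass, for otherwise `φ` vanishes almost everywhere; any `ε` below that
mass forces `s_ε ≥ s₀`. -/
theorem exists_le_truncationRadius {φ : ℝ → ℂ} (hφ : Integrable φ) (hφ0 : ¬ φ =ᵐ[volume] 0)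
    (hp : Tendsto (fun s : ℝ => tailExponent φ s / (s : EReal)) atTop (𝓝 ⊤)) :
    ∃ s₀ : ℝ, 0 < s₀ ∧ ∃ ε₁ : ℝ, 0 < ε₁ ∧ ∀ ε, 0 < ε → ε < ε₁ → s₀ ≤ truncationRadius φ ε := by
  obtain ⟨s₀, hs₀, hpos⟩ : ∃ s₀ : ℝ, 0 < s₀ ∧ 0 < ∫⁻ t in {t : ℝ | s₀ ≤ |t|}, ‖φ t‖ₑ := by
    by_contra! hcon
    have h0 := setLIntegral_lt_abs_le φ 0 (C := 0) hcon
    have hae : {t : ℝ | 0 < |t|} =ᵐ[volume] Set.univ := by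
      have : {t : ℝ | 0 < |t|} = {0}ᶜ := by ext t; simp
      rw [this, ae_eq_univ, compl_compl]
      simp
    rw [setLIntegral_congr hae, setLIntegral_univ, nonpos_iff_eq_zero,
      lintegral_eq_zero_iff' hφ.aestronglyMeasurable.enorm] at h0
    exact hφ0 (h0.mono fun t ht => by simpa using ht)
  obtain ⟨ε₁, hε₁, hlt⟩ := ENNReal.lt_iff_exists_real_btwn.1 hpos
  refine ⟨s₀, hs₀, ε₁, ENNReal.ofReal_pos.1 hlt.1, fun ε hε hεε => ?_⟩
  refine le_csInf (truncationSet_nonempty hp hε) fun s hs => ?_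
  by_contra! hss
  have h1 := (tail_antitone φ hss.le).trans (mem_truncationSet.1 hs).2
  exact absurd (h1.trans (ENNReal.ofReal_le_ofReal hεε.le)) (not_le.2 hlt.2)

theorem measurableSet_abs_le (s : ℝ) : MeasurableSet {t : ℝ | |t| ≤ s} :=
  measurableSet_le continuous_abs.measurable measurable_const

theorem integrable_truncation {φ : ℝ → ℂ} (hφ : Integrable φ) (ε : ℝ) :
    Integrable (truncation φ ε) :=
  hφ.indicator (measurableSet_abs_le _)

theorem truncation_eq_zero {φ : ℝ → ℂ} {ε : ℝ} (t : ℝ) (ht : truncationRadius φ ε < |t|) :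
    truncation φ ε t = 0 :=
  Set.indicator_of_notMem (by simpa using ht) _

theorem differentiable_truncatedLaplace {φ : ℝ → ℂ} (hφ : Integrable φ) (ε : ℝ) :
    Differentiable ℂ (truncatedLaplace φ ε) :=
  differentiable_integral_cexp_mul (integrable_truncation hφ ε) truncation_eq_zero

theorem norm_truncatedLaplace_le {φ : ℝ → ℂ} (hφ : Integrable φ) (ε : ℝ) (z : ℂ) :
    ‖truncatedLaplace φ ε z‖ ≤ (∫ t, ‖φ t‖) * Real.exp (truncationRadius φ ε * ‖z‖) := by
  refine (norm_integral_cexp_mul_le (integrable_truncation hφ ε) truncation_eq_zero z).trans ?_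
  refine mul_le_mul_of_nonneg_right (integral_mono (integrable_truncation hφ ε).norm hφ.norm
    fun t => norm_indicator_le_norm_self _ _) (Real.exp_nonneg _)

/-- On the imaginary axis, truncation changes the Laplace transform by at most `ε`. -/
theorem norm_integral_cexp_sub_truncatedLaplace_le {φ : ℝ → ℂ} (hφ : Integrable φ)
    (hp : Tendsto (fun s : ℝ => tailExponent φ s / (s : EReal)) atTop (𝓝 ⊤)) {ε : ℝ} (hε : 0 < ε)
    (y : ℝ) :
    ‖(∫ t : ℝ, Complex.exp ((y * Complex.I : ℂ) * (t : ℂ)) * φ t) -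
      truncatedLaplace φ ε (y * Complex.I)‖ ≤ ε := by
  have hnorm : ∀ t : ℝ, ‖Complex.exp ((y * Complex.I : ℂ) * (t : ℂ))‖ = 1 := fun t => by
    have : (y * Complex.I : ℂ) * (t : ℂ) = ((y * t : ℝ) : ℂ) * Complex.I := by push_cast; ring
    rw [this, Complex.norm_exp_ofReal_mul_I]
  have hint : ∀ ψ : ℝ → ℂ, Integrable ψ →
      Integrable fun t : ℝ => Complex.exp ((y * Complex.I : ℂ) * (t : ℂ)) * ψ t := fun ψ hψ =>
    hψ.norm.mono' ((Continuous.aestronglyMeasurable (by fun_prop)).mul hψ.aestronglyMeasurable)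
      (Eventually.of_forall fun t => by rw [norm_mul, hnorm, one_mul])
  have hm : MeasurableSet {t : ℝ | truncationRadius φ ε < |t|} :=
    measurableSet_lt measurable_const continuous_abs.measurable
  have hE : ‖(∫ t : ℝ, Complex.exp ((y * Complex.I : ℂ) * (t : ℂ)) * φ t) -
      truncatedLaplace φ ε (y * Complex.I)‖ₑ ≤ ENNReal.ofReal ε := by
    rw [truncatedLaplace, ← integral_sub (hint _ hφ) (hint _ (integrable_truncation hφ ε))]
    refine (enorm_integral_le_lintegral_enorm _).trans
      (le_trans (le_of_eq ?_) (setLIntegral_truncationRadius_lt_abs_le hp hε))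
    rw [← lintegral_indicator hm]
    refine lintegral_congr fun t => ?_
    by_cases ht : truncationRadius φ ε < |t|
    · rw [Set.indicator_of_mem (by exact ht), truncation_eq_zero t ht, mul_zero, sub_zero,
        enorm_mul, ← ofReal_norm (Complex.exp _), hnorm]
      simp
    · rw [Set.indicator_of_notMem (by exact ht), truncation,
        Set.indicator_of_mem (by simpa using ht), sub_self, enorm_zero]
  rw [← ofReal_norm] at hE
  exact (ENNReal.ofReal_le_ofReal_iff hε.le).1 hE

end SmallValued

/-! ### Area of disks and comparison of exponents. -/

/-- The area is at most `π ∑ r_i² ≤ π (∑ r_i)² ≤ π T²`, hence at most `T` when `π T ≤ 1`. -/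
theorem volume_le_of_subset_iUnion_closedBall {B : Set ℂ} {N : ℕ} {c : Fin N → ℂ} {r : Fin N → ℝ}
    {T : ℝ} (hr : ∀ i, 0 < r i) (hB : B ⊆ ⋃ i, Metric.closedBall (c i) (r i))
    (hT : ∑ i, r i ≤ T) (hT1 : Real.pi * T ≤ 1) : volume B ≤ ENNReal.ofReal T := by
  have hs0 : 0 ≤ ∑ i, r i := Finset.sum_nonneg fun i _ => (hr i).le
  have hvol : ∀ i, volume (Metric.closedBall (c i) (r i)) = ENNReal.ofReal (r i ^ 2 * Real.pi) := by
    intro i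
    rw [Complex.volume_closedBall, ENNReal.ofReal_mul (by positivity),
      ENNReal.ofReal_pow (hr i).le]
    congr 1
    rw [← NNReal.coe_real_pi, ENNReal.ofReal_coe_nnreal]
  calc volume B ≤ volume (⋃ i, Metric.closedBall (c i) (r i)) := measure_mono hB
    _ ≤ ∑ i, volume (Metric.closedBall (c i) (r i)) := measure_iUnion_fintype_le _ _
    _ = ENNReal.ofReal (∑ i, r i ^ 2 * Real.pi) := by
        rw [ENNReal.ofReal_sum_of_nonneg fun i _ => by positivity]
        exact Finset.sum_congr rfl fun i _ => hvol i
    _ ≤ ENNReal.ofReal T := by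
        refine ENNReal.ofReal_le_ofReal ?_
        rw [← Finset.sum_mul]
        have h1 : ∑ i, r i ^ 2 ≤ (∑ i, r i) ^ 2 :=
          Finset.sum_sq_le_sq_sum_of_nonneg fun i _ => (hr i).le
        have h2 : (∑ i, r i) ^ 2 ≤ T ^ 2 := by gcongr
        nlinarith [Real.pi_pos, hs0.trans hT]

/-- The slack between the constants `15 e³` and `6 e³` absorbs a change of the center. -/
theorem eventually_cartan_exponent_lt {q : ℝ} (hq : 1 / 2 < q) (A : ℝ) {s₀ ζ : ℝ}
    (hs₀ : 0 < s₀) (hζ : 0 ≤ ζ) (γ : ℝ) :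
    ∀ᶠ R : ℝ in atTop, ∀ s, s₀ ≤ s →
      0 < A + s * (2 * Real.exp 1 * (R + ζ) + ζ) - γ ∧
      -(((q + 1 / 2) * Real.log R + Real.log (15 * Real.exp 3)) * (A + 2 * Real.exp 1 * s * R)) <
        γ - (2 + Real.log (6 * Real.exp 1 * (R + ζ) / R ^ (-q + 1 / 2))) *
          (A + s * (2 * Real.exp 1 * (R + ζ) + ζ) - γ) := by
  set b := Real.log (15 * Real.exp 3) with hb
  have he1 : 1 ≤ Real.exp 1 := Real.one_le_exp zero_le_one
  have hb' : b = Real.log 15 + 3 := by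
    rw [hb, Real.log_mul (by norm_num) (Real.exp_pos _).ne', Real.log_exp]
  have hb0 : 0 ≤ b := by
    have := Real.log_nonneg (show (1 : ℝ) ≤ 15 by norm_num)
    linarith
  set D := (2 * Real.exp 1 + 1) * ζ + |γ| / s₀ with hD
  have hD0 : 0 ≤ D := by positivity
  have ha : 0 < q + 1 / 2 := by linarith
  have hlog := Real.isLittleO_log_id_atTop.def (c := 1 / (4 * (D * (q + 1 / 2) + 1)))
    (by positivity)
  filter_upwards [hlog, eventually_gt_atTop (4 * (D * (1 + b))), eventually_ge_atTop (4 * ζ),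
    eventually_ge_atTop (|A| / s₀), eventually_ge_atTop 1, eventually_gt_atTop D]
    with R hR1 hR2 hR3 hR4 hR5 hR6 s hs
  have hR0 : 0 < R := by linarith
  have hs0 : 0 < s := hs₀.trans_le hs
  have hlR : 0 ≤ Real.log R := Real.log_nonneg hR5
  have hmain : 2 * (D * (1 + b + (q + 1 / 2) * Real.log R)) < R := by
    rw [Real.norm_eq_abs, abs_of_nonneg hlR, id, Real.norm_eq_abs, abs_of_pos hR0,
      div_mul_eq_mul_div, one_mul, le_div_iff₀ (by positivity)] at hR1
    nlinarith
  have hA : |A| ≤ s * R := by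
    rw [div_le_iff₀ hs₀] at hR4
    nlinarith
  have hγ : |γ| ≤ s * (|γ| / s₀) := by
    rw [mul_div_assoc', le_div_iff₀ hs₀, mul_comm]
    gcongr
  set L := A + 2 * Real.exp 1 * s * R with hL
  have hLs : s * R ≤ L := by
    have h1 := neg_abs_le A
    have h2 : 2 * (s * R) ≤ 2 * Real.exp 1 * s * R := by
      nlinarith [mul_pos hs0 hR0]
    linarith
  set E := s * ((2 * Real.exp 1 + 1) * ζ) - γ with hE
  have hEle : |E| ≤ s * D := by
    rw [hE, hD, mul_add]
    refine (abs_sub _ _).trans (add_le_add (le_of_eq (abs_of_nonneg (by positivity))) hγ)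
  have hexp : A + s * (2 * Real.exp 1 * (R + ζ) + ζ) - γ = L + E := by
    rw [hL, hE]; ring
  have hpos : 0 < L + E := by
    have := neg_abs_le E
    have : s * D < s * R := by gcongr
    linarith
  rw [hexp]
  refine ⟨hpos, ?_⟩
  set H' := (q + 1 / 2) * Real.log R + b with hH'
  have hlogH : 2 + Real.log (6 * Real.exp 1 * (R + ζ) / R ^ (-q + 1 / 2)) =
      3 + Real.log (6 * (R + ζ)) + (q - 1 / 2) * Real.log R := by
    rw [Real.log_div (by positivity) (by positivity), Real.log_rpow hR0,
      show 6 * Real.exp 1 * (R + ζ) = Real.exp 1 * (6 * (R + ζ)) by ring,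
      Real.log_mul (by positivity) (by positivity), Real.log_exp]
    ring
  rw [hlogH]
  set H := 3 + Real.log (6 * (R + ζ)) + (q - 1 / 2) * Real.log R with hH
  -- Since `ζ ≤ R/4`, `12 (R + ζ) ≤ 15 R`: this is the slack.
  have hHH : H ≤ H' - Real.log 2 := by
    have h1 : Real.log (6 * (R + ζ)) + Real.log 2 ≤ Real.log 15 + Real.log R := by
      rw [← Real.log_mul (by positivity) (by norm_num), ← Real.log_mul (by norm_num) hR0.ne']
      exact Real.log_le_log (by positivity) (by linarith)
    rw [hH', hH, hb']
    linarith
  have hH0 : 0 ≤ H := by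
    have h1 : 0 ≤ Real.log (6 * (R + ζ)) := Real.log_nonneg (by linarith)
    have h2 : 0 ≤ (q - 1 / 2) * Real.log R := mul_nonneg (by linarith) hlR
    linarith
  have hl2 : 1 / 2 < Real.log 2 := by linarith [Real.log_two_gt_d9]
  have hL0 : 0 ≤ L := (mul_pos hs0 hR0).le.trans hLs
  have h1 : H * L ≤ (H' - Real.log 2) * L := by gcongr
  have h2 : H * E ≤ H' * (s * D) := by
    have h3 : E ≤ s * D := (le_abs_self E).trans hEle
    have h4 : H ≤ H' := by linarith
    calc H * E ≤ H * (s * D) := by gcongr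
      _ ≤ H' * (s * D) := by gcongr
  have h3 : -γ ≤ s * D := by
    have : s * (|γ| / s₀) ≤ s * D := by
      gcongr
      rw [hD]
      have : 0 ≤ (2 * Real.exp 1 + 1) * ζ := by positivity
      linarith
    linarith [neg_le_abs γ]
  have h4 : s * (2 * (D * (1 + H'))) < s * R := by
    have : 1 + H' = 1 + b + (q + 1 / 2) * Real.log R := by rw [hH']; ring
    rw [this]
    gcongr
  have h5 : 1 / 2 * L ≤ Real.log 2 * L := by gcongr
  -- The errors total at most `s D (1 + H') < s R / 2 ≤ L / 2`, below the gain `L log 2`.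
  nlinarith

/-! ### Solutions of the radius equation and covering of the small-valued set. -/

namespace SmallValued

/-- The truncation radius grows slower than any multiple of `log (1 / ε)`. -/
theorem exists_forall_mul_truncationRadius_lt {φ : ℝ → ℂ}
    (hp : Tendsto (fun s : ℝ => tailExponent φ s / (s : EReal)) atTop (𝓝 ⊤)) {β : ℝ} (hβ : 0 < β)
    {D : ℝ} (hD : 0 < D) :
    ∃ ε₂ : ℝ, 0 < ε₂ ∧ ∀ ε, 0 < ε → ε < ε₂ →
      D * (1 + truncationRadius φ ε) < -Real.log (ε ^ β + ε) := by
  set m := min 1 β with hm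
  have hm0 : 0 < m := lt_min one_pos hβ
  -- `ε ^ β + ε ≤ 2 ε ^ m`; this `N` lets `D s_ε` use only half of `m log (1/ε)`, and `W` makes the
  -- other half exceed the constants.
  obtain ⟨s₁, hs₁, hle⟩ := exists_truncationRadius_le hp (N := 2 * D / m) (by positivity)
  set W := 2 * (D + D * s₁ + Real.log 2) / m with hW
  have hW0 : 0 < W := by have := Real.log_pos one_lt_two; positivity
  refine ⟨Real.exp (-W), Real.exp_pos _, fun ε hε hεW => ?_⟩
  have hε1 : ε ≤ 1 := hεW.le.trans (Real.exp_le_one_iff.2 (by linarith))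
  have hℓ : W < -Real.log ε := by
    have := (Real.log_lt_iff_lt_exp hε).2 hεW
    linarith
  have hlog : Real.log (ε ^ β + ε) ≤ Real.log 2 + m * Real.log ε := by
    rw [← Real.log_rpow hε, ← Real.log_mul two_ne_zero (by positivity)]
    refine Real.log_le_log (by positivity) ?_
    have h1 : ε ^ β ≤ ε ^ m := Real.rpow_le_rpow_of_exponent_ge hε hε1 (min_le_right _ _)
    have h2 : ε ^ (1 : ℝ) ≤ ε ^ m := Real.rpow_le_rpow_of_exponent_ge hε hε1 (min_le_left _ _)
    rw [Real.rpow_one] at h2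
    linarith
  have hs : truncationRadius φ ε ≤ s₁ + -Real.log ε / (2 * D / m) := by
    refine (hle ε hε).trans (max_le_add_of_nonneg hs₁.le ?_)
    have : 0 ≤ -Real.log ε := by linarith
    positivity
  have h3 : D * truncationRadius φ ε ≤ D * s₁ + m * (-Real.log ε) / 2 := by
    refine (mul_le_mul_of_nonneg_left hs hD.le).trans (le_of_eq ?_)
    field_simp
  have h4 : 2 * (D + D * s₁ + Real.log 2) < m * (-Real.log ε) := by
    rw [hW, div_lt_iff₀ hm0] at hℓ
    linarith
  linarith

theorem exists_one_lt_radiusEquation {φ : ℝ → ℂ} {q β ε : ℝ} (hq : 1 / 2 < q)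
    (hs : 0 < truncationRadius φ ε)
    (h1 : Real.log (15 * Real.exp 3) *
      (Real.log (∫ t : ℝ, ‖φ t‖) + 2 * Real.exp 1 * truncationRadius φ ε) <
        -Real.log (ε ^ β + ε)) :
    ∃ R : ℝ, 1 < R ∧ RadiusEquation φ q β ε R := by
  set F : ℝ → ℝ := fun R => ((q + 1 / 2) * Real.log R + Real.log (15 * Real.exp 3)) *
      (Real.log (∫ t : ℝ, ‖φ t‖) + 2 * Real.exp 1 * truncationRadius φ ε * R) with hF
  have hF1 : F 1 < -Real.log (ε ^ β + ε) := by simpa [hF] using h1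
  have hFt : Tendsto F atTop atTop := by
    refine Tendsto.atTop_mul_atTop₀ ?_ ?_
    · exact tendsto_atTop_add_const_right _ _
        (Real.tendsto_log_atTop.const_mul_atTop (by linarith))
    · exact tendsto_atTop_add_const_left _ _ (tendsto_id.const_mul_atTop (by positivity))
  obtain ⟨R₁, hR₁, hR₁1⟩ := ((hFt.eventually_ge_atTop (-Real.log (ε ^ β + ε))).and
    (eventually_ge_atTop 1)).exists
  have hcont : ContinuousOn F (Set.Icc 1 R₁) := by
    have : ContinuousOn Real.log (Set.Icc 1 R₁) := Real.continuousOn_log.mono fun x hx => by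
      have : (0 : ℝ) < x := by linarith [hx.1]
      simpa using this.ne'
    fun_prop
  obtain ⟨R, hR, hRF⟩ := intermediate_value_Icc hR₁1 hcont ⟨hF1.le, hR₁⟩
  refine ⟨R, lt_of_le_of_ne hR.1 ?_, hRF⟩
  rintro rfl
  exact hF1.ne hRF

theorem smallValuedSet_subset_closedBall (φ : ℝ → ℂ) (β ε R : ℝ) :
    smallValuedSet φ β ε R ⊆ Metric.closedBall 0 R := fun z hz => by
  simpa using hz.2

/-- The exponent is negative, so the allowed bound is at least 1, while the whole disk has radius
below 1 and area at most `π/4`. -/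
theorem smallValuedSet_covered_of_lt_half {φ : ℝ → ℂ} {q β ε R : ℝ} (hq : 1 / 2 < q) (hR : 0 < R)
    (hR2 : R < 1 / 2) :
    volume (smallValuedSet φ β ε R) ≤ ENNReal.ofReal (R ^ (-q + 1 / 2)) ∧
      ∃ (n : ℕ) (c : Fin n → ℂ) (r : Fin n → ℝ), (∀ i, 0 < r i) ∧
        smallValuedSet φ β ε R ⊆ ⋃ i, Metric.closedBall (c i) (r i) ∧
        ∑ i, r i ≤ R ^ (-q + 1 / 2) := by
  have hT : 1 ≤ R ^ (-q + 1 / 2) :=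
    Real.one_le_rpow_of_pos_of_le_one_of_nonpos hR (by linarith) (by linarith)
  constructor
  · refine (measure_mono (smallValuedSet_subset_closedBall φ β ε R)).trans ?_
    rw [Complex.volume_closedBall, ← ENNReal.ofReal_pow hR.le, ← ENNReal.ofReal_coe_nnreal,
      NNReal.coe_real_pi, ← ENNReal.ofReal_mul (by positivity)]
    refine ENNReal.ofReal_le_ofReal (le_trans ?_ hT)
    have h1 : R ^ 2 ≤ 1 / 4 := by nlinarith
    nlinarith [Real.pi_le_four, Real.pi_pos]
  · exact ⟨1, fun _ => 0, fun _ => R, fun _ => hR,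
      (smallValuedSet_subset_closedBall φ β ε R).trans
        (Set.subset_iUnion_of_subset 0 (le_refl _)), by simpa using by linarith⟩

/-- Cartan's estimate applied to the truncated Laplace transform, centered at `z₀`. -/
theorem smallValuedSet_covered {φ : ℝ → ℂ} (hφ : Integrable φ) {β ε : ℝ} {z₀ : ℂ} {κ : ℝ}
    (hε : 0 < ε) (hκ : 0 < κ) (hz₀ : κ ≤ ‖truncatedLaplace φ ε z₀‖) (hI : 0 < ∫ t, ‖φ t‖)
    {R T : ℝ} (hR : 0 < R) (hT : 0 < T) (hTR : T ≤ 6 * Real.exp 1 * (R + ‖z₀‖))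
    (hpos : 0 < Real.log (∫ t, ‖φ t‖) +
      truncationRadius φ ε * (2 * Real.exp 1 * (R + ‖z₀‖) + ‖z₀‖) - Real.log κ)
    (hlt : Real.log (ε ^ β + ε) < Real.log κ -
      (2 + Real.log (6 * Real.exp 1 * (R + ‖z₀‖) / T)) * (Real.log (∫ t, ‖φ t‖) +
        truncationRadius φ ε * (2 * Real.exp 1 * (R + ‖z₀‖) + ‖z₀‖) - Real.log κ)) :
    ∃ (n : ℕ) (c : Fin n → ℂ) (r : Fin n → ℝ), (∀ i, 0 < r i) ∧
      smallValuedSet φ β ε R ⊆ ⋃ i, Metric.closedBall (c i) (r i) ∧ ∑ i, r i ≤ T := by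
  set G := truncatedLaplace φ ε with hG
  set s := truncationRadius φ ε with hs
  have hs0 : 0 ≤ s := truncationRadius_nonneg φ ε
  have hGd : Differentiable ℂ G := differentiable_truncatedLaplace hφ ε
  have hG0 : 0 < ‖G z₀‖ := hκ.trans_le hz₀
  -- `e^X` bounds `|G (z₀ + w) / G z₀|` on `|w| ≤ 2e (R + |z₀|)`; the disk of radius `R + |z₀|`
  -- about `z₀` contains `|z| ≤ R`.
  set X := Real.log (∫ t, ‖φ t‖) + s * (2 * Real.exp 1 * (R + ‖z₀‖) + ‖z₀‖) - Real.log κ with hX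
  have hXexp : Real.exp X =
      (∫ t, ‖φ t‖) * Real.exp (s * (2 * Real.exp 1 * (R + ‖z₀‖) + ‖z₀‖)) / κ := by
    rw [hX, Real.exp_sub, Real.exp_add, Real.exp_log hI, Real.exp_log hκ]
  obtain ⟨n, c, r, hr, hsum, hlow⟩ := exists_disks_exp_le_norm
    (f := fun w => G (z₀ + w) / G z₀) (R := R + ‖z₀‖) (M := Real.exp X) (T := T)
    ((hGd.comp (differentiable_id.const_add z₀)).div_const _)
    (by rw [add_zero, div_self (norm_pos_iff.1 hG0), norm_one])
    (by positivity) (Real.one_lt_exp_iff.2 hpos) hT hTR (fun w hw => by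
      rw [hXexp, norm_div]
      gcongr
      refine (norm_truncatedLaplace_le hφ ε _).trans ?_
      have h1 : ‖z₀ + w‖ ≤ 2 * Real.exp 1 * (R + ‖z₀‖) + ‖z₀‖ :=
        (norm_add_le _ _).trans (by linarith)
      gcongr)
  refine ⟨n, fun i => z₀ + c i, r, hr, fun z hz => ?_, hsum⟩
  by_contra hcon
  have hz2 := hz.2
  have h := hlow (z - z₀) ((norm_sub_le _ _).trans (by linarith)) fun i hi => hcon <| by
    refine Set.mem_iUnion.2 ⟨i, ?_⟩
    rw [Metric.mem_closedBall, dist_eq_norm] at hi ⊢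
    rwa [← sub_sub]
  rw [add_sub_cancel, Real.log_exp, norm_div, le_div_iff₀ hG0] at h
  have h2 : Real.exp (Real.log κ - (2 + Real.log (6 * Real.exp 1 * (R + ‖z₀‖) / T)) * X) ≤
      ‖G z‖ := by
    refine le_trans ?_ h
    rw [sub_eq_neg_add, Real.exp_add, Real.exp_log hκ]
    gcongr
  have h3 := (Real.log_lt_iff_lt_exp (by positivity)).1 hlt
  exact absurd hz.1 (not_le.2 (h3.trans_le h2))

end SmallValued

/-! ### Main theorem. -/

theorem theorem4 (φ : ℝ → ℂ) (hφ : Integrable φ volume) (hφ0 : ¬ φ =ᵐ[volume] 0)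
    (hp : Tendsto (fun s : ℝ => SmallValued.tailExponent φ s / (s : EReal)) atTop (𝓝 ⊤))
    (q : ℝ) (hq : 1 / 2 < q) (β : ℝ) (hβ : 0 < β) :
    ∃ ε₀ : ℝ, 0 < ε₀ ∧ ∀ ε : ℝ, 0 < ε → ε < ε₀ →
      (∃ R : ℝ, 1 < R ∧ SmallValued.RadiusEquation φ q β ε R) ∧
      ∀ R : ℝ, 0 < R → SmallValued.RadiusEquation φ q β ε R →
        volume (SmallValued.smallValuedSet φ β ε R) ≤ ENNReal.ofReal (R ^ (-q + 1 / 2)) ∧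
        ∃ (n : ℕ) (c : Fin n → ℂ) (r : Fin n → ℝ), (∀ i, 0 < r i) ∧
          SmallValued.smallValuedSet φ β ε R ⊆ ⋃ i, Metric.closedBall (c i) (r i) ∧
          ∑ i, r i ≤ R ^ (-q + 1 / 2) := by
  have hI : 0 < ∫ t, ‖φ t‖ := by
    refine lt_of_le_of_ne (integral_nonneg fun t => norm_nonneg _) fun h => hφ0 ?_
    have := (integral_eq_zero_iff_of_nonneg (fun t => norm_nonneg (φ t)) hφ.norm).1 h.symm
    exact this.mono fun t ht => by simpa using ht
  obtain ⟨y, hy⟩ := exists_integral_cexp_mul_ne_zero hφ hφ0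
  set v := ∫ t : ℝ, Complex.exp ((y * Complex.I : ℂ) * (t : ℂ)) * φ t with hv
  set z₀ : ℂ := y * Complex.I with hz₀
  set κ := ‖v‖ / 2 with hκ
  have hκ0 : 0 < κ := half_pos (norm_pos_iff.2 hy)
  obtain ⟨s₀, hs₀, ε₁, hε₁, hsε⟩ := SmallValued.exists_le_truncationRadius hφ hφ0 hp
  set A := Real.log (∫ t, ‖φ t‖) with hA
  have hev := eventually_cartan_exponent_lt hq A hs₀ (norm_nonneg z₀) (Real.log κ)
  have hevT : ∀ᶠ R : ℝ in atTop, Real.pi * R ^ (-(q - 1 / 2)) ≤ 1 := by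
    have h := (tendsto_rpow_neg_atTop (show 0 < q - 1 / 2 by linarith)).const_mul Real.pi
    rw [mul_zero] at h
    exact h.eventually_le_const one_pos
  obtain ⟨K', hK'⟩ := eventually_atTop.1 (hev.and hevT)
  set K := max K' 1 with hK
  have hK1 : 1 ≤ K := le_max_right _ _
  set b := Real.log (15 * Real.exp 3) with hb
  have hb0 : 0 < b := Real.log_pos (by
    have := Real.one_le_exp (show (0 : ℝ) ≤ 3 by norm_num)
    linarith)
  have he : 0 < Real.exp 1 := Real.exp_pos 1
  have hl2K : 0 < Real.log (2 * K) := Real.log_pos (by linarith)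
  set D := ((q + 1 / 2) * Real.log (2 * K) + b) * (|A| + 2 * Real.exp 1 * K) with hD
  have hD0 : 0 < D := by
    have : 0 < q + 1 / 2 := by linarith
    positivity
  obtain ⟨ε₂, hε₂, hlarge⟩ := SmallValued.exists_forall_mul_truncationRadius_lt hp hβ hD0
  -- On `[1/2, K]` one has `|log R| ≤ log (2K)`. The bound excludes solutions there and, at `R = 1`,
  -- starts the intermediate value argument.
  have hmid : ∀ s R : ℝ, 0 ≤ s → 1 / 2 ≤ R → R ≤ K →
      ((q + 1 / 2) * Real.log R + b) * (A + 2 * Real.exp 1 * s * R) ≤ D * (1 + s) := by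
    intro s R hs hR hRK
    have hR0 : 0 < R := by linarith
    have h1 : |(q + 1 / 2) * Real.log R + b| ≤ (q + 1 / 2) * Real.log (2 * K) + b := by
      refine (abs_add_le _ _).trans (add_le_add ?_ (le_of_eq (abs_of_pos hb0)))
      rw [abs_mul, abs_of_pos (show 0 < q + 1 / 2 by linarith)]
      refine mul_le_mul_of_nonneg_left (abs_le.2 ⟨?_, Real.log_le_log hR0 (by linarith)⟩)
        (by linarith)
      rw [← Real.log_inv]
      refine Real.log_le_log (by positivity) (le_trans ?_ hR)
      rw [one_div]
      exact inv_anti₀ two_pos (by linarith)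
    have h2 : |A + 2 * Real.exp 1 * s * R| ≤ (|A| + 2 * Real.exp 1 * K) * (1 + s) := by
      refine (abs_add_le _ _).trans ?_
      rw [abs_of_nonneg (show 0 ≤ 2 * Real.exp 1 * s * R by positivity)]
      have h3 : 2 * Real.exp 1 * s * R ≤ 2 * Real.exp 1 * s * K := by gcongr
      have h4 : 0 ≤ |A| * s := by positivity
      have h5 : 0 ≤ 2 * Real.exp 1 * K := by positivity
      nlinarith
    calc _ ≤ |(q + 1 / 2) * Real.log R + b| * |A + 2 * Real.exp 1 * s * R| := by
          rw [← abs_mul]; exact le_abs_self _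
      _ ≤ ((q + 1 / 2) * Real.log (2 * K) + b) * ((|A| + 2 * Real.exp 1 * K) * (1 + s)) :=
          mul_le_mul h1 h2 (abs_nonneg _) ((abs_nonneg _).trans h1)
      _ = D * (1 + s) := by rw [hD]; ring
  -- `ε₁` ensures `s_ε ≥ s₀`, `ε₂` makes the right side exceed `D (1 + s_ε)`, and `κ` leaves
  -- `|Φ^ε(z₀)| ≥ 2κ - ε ≥ κ`.
  refine ⟨min ε₁ (min ε₂ κ), by positivity, fun ε hε hlt => ?_⟩
  have hlt1 : ε < ε₁ := hlt.trans_le (min_le_left _ _)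
  have hlt2 : ε < ε₂ := hlt.trans_le ((min_le_right _ _).trans (min_le_left _ _))
  have hlt3 : ε < κ := hlt.trans_le ((min_le_right _ _).trans (min_le_right _ _))
  have hs := hsε ε hε hlt1
  have hs0 := SmallValued.truncationRadius_nonneg φ ε
  have hbig := hlarge ε hε hlt2
  refine ⟨SmallValued.exists_one_lt_radiusEquation hq (hs₀.trans_le hs) ?_, fun R hR hRE => ?_⟩
  · have := hmid _ 1 hs0 (by norm_num) hK1
    rw [Real.log_one, mul_zero, zero_add, mul_one] at this
    exact this.trans_lt hbig
  · rcases lt_or_ge R (1 / 2) with hR2 | hR2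
    · exact SmallValued.smallValuedSet_covered_of_lt_half hq hR hR2
    · have hKR : K < R := by
        by_contra! hRK
        have := hmid _ R hs0 hR2 hRK
        rw [SmallValued.RadiusEquation] at hRE
        linarith
      obtain ⟨hcart, hTπ⟩ := hK' R ((le_max_left _ _).trans hKR.le)
      obtain ⟨hpos, hexp⟩ := hcart _ hs
      rw [neg_sub, sub_eq_neg_add, one_div] at hTπ
      have hz₀κ : κ ≤ ‖SmallValued.truncatedLaplace φ ε z₀‖ := by
        have h1 := SmallValued.norm_integral_cexp_sub_truncatedLaplace_le hφ hp hε y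
        have h2 := norm_le_norm_add_norm_sub' v (SmallValued.truncatedLaplace φ ε z₀)
        have h3 : ‖v‖ = 2 * κ := by rw [hκ]; ring
        linarith
      have hT0 : 0 < R ^ (-q + 1 / 2) := Real.rpow_pos_of_pos hR _
      have hT1 : R ^ (-q + 1 / 2) ≤ 1 :=
        Real.rpow_le_one_of_one_le_of_nonpos (by linarith) (by linarith)
      have he1 : 1 ≤ Real.exp 1 := Real.one_le_exp zero_le_one
      obtain ⟨n, c, r, hr, hsub, hsum⟩ := SmallValued.smallValuedSet_covered (β := β) hφ hε hκ0 hz₀κ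
        hI hR hT0 (by nlinarith [norm_nonneg z₀]) hpos (by
          rw [SmallValued.RadiusEquation] at hRE
          rw [hRE, neg_neg] at hexp
          exact hexp)
      refine ⟨volume_le_of_subset_iUnion_closedBall hr hsub hsum ?_, n, c, r, hr, hsub, hsum⟩
      rwa [one_div]
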